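/- Let $(X,\mathcal F)$ be a measurable space, $Y\subset\mathbb R$ a nonempty closed interval with a finite least element $\underline y$ (so $Y=[\underline y,\bar y]$ or $Y=[\underline y,+\infty)$), equipped with its Borel $\sigma$-algebra $\mathcal B$, and $\theta$ a probability measure on $(X\times Y,\mathcal F\otimes\mathcal B)$. Let $Q$ be a Polish space, $(p_0,q_0)\in\mathbb R\times Q$, $V:X\times\mathbb R\times Q\to\mathbb R$ and $C:\mathbb R\times Q\to\mathbb R\cup\{+\infty\}$. Call a measurable map $(p,q):X\times Y\to\mathbb R\times Q$ a *budget-constrained-feasible contract* if for all $(x,y),(x',y')\in X\times Y$: 1. $p(x,y)\le y$; 2. $V(x,p(x,y),q(x,y))\ge V(x,p_0,q_0)$; 3. if $p(x',y')\le y$, then $V(x,p(x,y),q(x,y))\ge V(x,p(x',y'),q(x',y'))$. Assume that: - $p_0\le\underline y$; - $V(x,\cdot,\cdot)$ is continuous on $\mathbb R\times Q$ for every $x\in X$, and $V(\cdot,p,q)$ is $\mathcal F$-measurable for every $(p,q)\in\mathbb R\times Q$; - $C$ is lower semicontinuous and $C(p_0,q_0)<+\infty$; - the closure $\Gamma$ of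 the set of all $(p,q)\in\mathbb R\times Q$ such that $C(p,q)\le C(p_0,q_0)$ and, for some $(x,y)\in X\times Y$, both $p\le y$ and $V(x,p,q)\ge V(x,p_0,q_0)$, is compact; - $\theta(S)=0$ for every measurable $S\subset X\times Y$ such that the slice $S_x=\{y\in Y:(x,y)\in S\}$ is at most countable for every $x\in X$. Then for every budget-constrained-feasible contract $(p,q)$ the integral $\int_{X\times Y}C(p(x,y),q(x,y))\,d\theta(x,y)$ is well defined in $(-\infty,+\infty]$, and the problem $$\inf\Big\{\int_{X\times Y}C(p(x,y),q(x,y))\,d\theta(x,y)\;:\;(p,q)\text{ budget-constrained-feasible}\Big\}$$ admits at least one solution, i.e. the infimum is attained by a budget-constrained-feasible contract. -/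

import Mathlib

open MeasureTheory
open scoped ENNReal

namespace BudgetPrincipalAgent

/-- Integral of an extended-real function: integral of the positive part minus integral of the
negative part. It is meaningful as soon as the negative part has finite integral. -/
noncomputable def integralEReal {α : Type*} [MeasurableSpace α] (μ : Measure α) (f : α → EReal) :
    EReal :=
  ((∫⁻ a, (f a).toENNReal ∂μ : ℝ≥0∞) : EReal) - ((∫⁻ a, (-f a).toENNReal ∂μ : ℝ≥0∞) : EReal)

/-- Budget-constrained-feasible contracts. A type is a pair `t = (x, y)` of a preference parameter
and a budget; a contract `z` assigns to it a pair `z t = (p, q)` of a price and an allocation.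
`V` is the agents' utility and `z₀ = (p₀, q₀)` the outside option. -/
structure IsFeasible {X Q : Type*} [MeasurableSpace X] [MeasurableSpace Q] {Y : Set ℝ}
    (V : X → ℝ × Q → ℝ) (z₀ : ℝ × Q) (z : X × Y → ℝ × Q) : Prop where
  measurable : Measurable z
  budget : ∀ (x : X) (y : Y), (z (x, y)).1 ≤ (y : ℝ)
  individuallyRational : ∀ (x : X) (y : Y), V x z₀ ≤ V x (z (x, y))
  incentiveCompatible : ∀ (x : X) (y : Y) (x' : X) (y' : Y),
    (z (x', y')).1 ≤ (y : ℝ) → V x (z (x', y')) ≤ V x (z (x, y))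

/-- The principal's expected cost of the contract `z`. -/
noncomputable def expectedCost {X Q : Type*} [MeasurableSpace X] {Y : Set ℝ}
    (θ : Measure (X × Y)) (C : ℝ × Q → EReal) (z : X × Y → ℝ × Q) : EReal :=
  integralEReal θ fun t => C (z t)

/-- `z` solves the principal's problem: it is feasible and attains the least expected cost among
all feasible contracts. -/
structure IsOptimal {X Q : Type*} [MeasurableSpace X] [MeasurableSpace Q] {Y : Set ℝ}
    (θ : Measure (X × Y)) (V : X → ℝ × Q → ℝ) (C : ℝ × Q → EReal) (z₀ : ℝ × Q)
    (z : X × Y → ℝ × Q) : Prop where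
  feasible : IsFeasible V z₀ z
  minimal : ∀ w : X × Y → ℝ × Q, IsFeasible V z₀ w → expectedCost θ C z ≤ expectedCost θ C w

/-- The coercivity set: closure of the set of pairs `(p, q)` at most as costly as the outside
option and, for at least one type, affordable and weakly preferred to the outside option. -/
def coercivitySet {X Q : Type*} [TopologicalSpace Q] (Y : Set ℝ)
    (V : X → ℝ × Q → ℝ) (C : ℝ × Q → EReal) (z₀ : ℝ × Q) : Set (ℝ × Q) :=
  closure {z | C z ≤ C z₀ ∧ ∃ (x : X) (y : Y), z.1 ≤ (y : ℝ) ∧ V x z₀ ≤ V x z}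

end BudgetPrincipalAgent

/-! A contract amounts to a menu from which each type takes a best affordable item. Once items
costing more than `C z₀` are dropped, the menus of a minimizing sequence lie in the compact
coercivity set and subconverge in Hausdorff distance to a compact menu `K`
(`exists_hausdorff_convergent_subseq`). The candidate gives each type a cheapest element of its
demand in `K`, chosen measurably (`exists_measurable_cheapest_demand`).

The difficulty is the budget: an item of `K` priced exactly at the budget may be a limit of
unaffordable items. Only strictly cheaper items bound the limiting choices from below, which
suffices unless the indirect utility jumps at the budget. Being monotone in the budget, it jumps at
countably many budgets for each `x` (`countable_jump_budgets`), so such types are `θ`-null. For the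
others, limits of cheap choices lie in the demand (`mem_demand_of_frequently_mem_nhds`), and dropped
choices cost more than the candidate. Lower semicontinuity gives `le_liminf_cost`, and Fatou's lemma
concludes. -/

namespace BudgetPrincipalAgent

open Set Filter Topology

/-! ### Measurable correspondences and measurable selection. -/

section Correspondences

variable {T Z : Type*} [MeasurableSpace T]

/-- A correspondence is hit-measurable if the set of points at which it meets a given closed set
is measurable. -/
def HitMeasurable [TopologicalSpace Z] (Φ : T → Set Z) : Prop :=
  ∀ F : Set Z, IsClosed F → MeasurableSet {t | (Φ t ∩ F).Nonempty}

/-- The minimizers of `f` in `s`. -/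
def argminOn (f : Z → EReal) (s : Set Z) : Set Z :=
  {m ∈ s | ∀ m' ∈ s, f m ≤ f m'}

theorem argminOn_eq_inter {f : Z → EReal} {s : Set Z} :
    argminOn f s = s ∩ {m | f m ≤ ⨅ m' ∈ s, f m'} := by
  ext m; simp [argminOn, le_iInf_iff]

theorem isCompact_argminOn [TopologicalSpace Z] {f : Z → EReal} (hf : LowerSemicontinuous f)
    {s : Set Z} (hs : IsCompact s) : IsCompact (argminOn f s) := by
  rw [argminOn_eq_inter]
  exact hs.inter_right (hf.isClosed_preimage _)

theorem argminOn_nonempty [TopologicalSpace Z] {f : Z → EReal} (hf : LowerSemicontinuous f)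
    {s : Set Z} (hs : IsCompact s) (hne : s.Nonempty) : (argminOn f s).Nonempty := by
  obtain ⟨m, hm, hmin⟩ := (hf.lowerSemicontinuousOn s).exists_isMinOn hne hs
  exact ⟨m, hm, fun m' hm' => hmin hm'⟩

/-- The minimal value of a lower semicontinuous function on a compact-valued hit-measurable
correspondence is measurable. -/
theorem measurable_iInf_of_hitMeasurable [TopologicalSpace Z] {f : Z → EReal}
    (hf : LowerSemicontinuous f) {Φ : T → Set Z} (hΦ : HitMeasurable Φ)
    (hc : ∀ t, IsCompact (Φ t)) {F : Set Z} (hF : IsClosed F) :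
    Measurable fun t => ⨅ m ∈ Φ t ∩ F, f m := by
  refine measurable_of_Iic fun c => ?_
  -- The infimum over an empty set is `⊤`, so only for `c ≠ ⊤` does the bound force an intersection.
  rcases eq_or_ne c ⊤ with rfl | hctop
  · simp
  · convert hΦ _ (hF.inter (hf.isClosed_preimage c)) using 1
    ext t
    simp only [mem_preimage, mem_Iic, mem_ofPred_eq]
    constructor
    · intro h
      have hne : (Φ t ∩ F).Nonempty := by
        by_contra hemp
        rw [not_nonempty_iff_eq_empty] at hemp
        simp [hemp] at h
        exact hctop h
      obtain ⟨m, hm, hmin⟩ :=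
        (hf.lowerSemicontinuousOn _).exists_isMinOn hne ((hc t).inter_right hF)
      exact ⟨m, hm.1, hm.2, (le_iInf₂ fun m' hm' => hmin hm').trans h⟩
    · rintro ⟨m, hm, hmF, hmc⟩
      exact (iInf₂_le m ⟨hm, hmF⟩).trans hmc

/-- Some minimizer lies in `F` exactly when `Φ t` meets `F` and the infimum over `Φ t ∩ F` does not
exceed that over `Φ t`; both infima are measurable in `t`. -/
theorem HitMeasurable.argminOn [TopologicalSpace Z] {f : Z → EReal}
    (hf : LowerSemicontinuous f) {Φ : T → Set Z} (hΦ : HitMeasurable Φ)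
    (hc : ∀ t, IsCompact (Φ t)) : HitMeasurable fun t => argminOn f (Φ t) := by
  intro F hF
  have h1 := measurable_iInf_of_hitMeasurable hf hΦ hc hF
  have h2 := measurable_iInf_of_hitMeasurable hf hΦ hc isClosed_univ
  convert (hΦ F hF).inter (measurableSet_le h1 h2) using 1
  ext t
  simp only [inter_univ, mem_inter_iff, mem_ofPred_eq]
  constructor
  · rintro ⟨m, ⟨hm, hmin⟩, hmF⟩
    exact ⟨⟨m, hm, hmF⟩, (iInf₂_le m ⟨hm, hmF⟩).trans (le_iInf₂ hmin)⟩
  · rintro ⟨hne, hle⟩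
    obtain ⟨m, hm, hmin⟩ :=
      (hf.lowerSemicontinuousOn _).exists_isMinOn hne ((hc t).inter_right hF)
    refine ⟨m, ⟨hm.1, fun m' hm' => ?_⟩, hm.2⟩
    exact ((le_iInf₂ fun m' hm' => hmin hm').trans hle).trans (iInf₂_le m' hm')

/-- The correspondence obtained from `Φ` by successively minimizing the distances to the points
of a sequence. -/
def lexArgmin [MetricSpace Z] (d : ℕ → Z) (s : Set Z) : ℕ → Set Z
  | 0 => s
  | n + 1 => argminOn (fun m => ((dist m (d n) : ℝ) : EReal)) (lexArgmin d s n)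

theorem lowerSemicontinuous_dist_coe [MetricSpace Z] (a : Z) :
    LowerSemicontinuous fun m : Z => ((dist m a : ℝ) : EReal) :=
  (continuous_coe_real_ereal.comp (continuous_id.dist continuous_const)).lowerSemicontinuous

/-- Measurable selection for hit-measurable correspondences with nonempty compact values. -/
theorem HitMeasurable.exists_measurable_selection [MetricSpace Z] [SecondCountableTopology Z]
    [MeasurableSpace Z] [BorelSpace Z] {Φ : T → Set Z} (hΦ : HitMeasurable Φ)
    (hc : ∀ t, IsCompact (Φ t)) (hne : ∀ t, (Φ t).Nonempty) :
    ∃ z : T → Z, Measurable z ∧ ∀ t, z t ∈ Φ t := by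
  rcases isEmpty_or_nonempty T with hT | ⟨⟨t₀⟩⟩
  · exact ⟨fun t => isEmptyElim t, measurable_of_empty _, fun t => isEmptyElim t⟩
  have : Nonempty Z := ⟨(hne t₀).some⟩
  let d := TopologicalSpace.denseSeq Z
  have hcomp : ∀ t n, IsCompact (lexArgmin d (Φ t) n) := by
    intro t n
    induction n with
    | zero => exact hc t
    | succ n ih => exact isCompact_argminOn (lowerSemicontinuous_dist_coe _) ih
  have hnon : ∀ t n, (lexArgmin d (Φ t) n).Nonempty := by
    intro t n
    induction n with
    | zero => exact hne t
    | succ n ih => exact argminOn_nonempty (lowerSemicontinuous_dist_coe _) (hcomp t n) ih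
  have hmeas : ∀ n, HitMeasurable fun t => lexArgmin d (Φ t) n := by
    intro n
    induction n with
    | zero => exact hΦ
    | succ n ih => exact ih.argminOn (lowerSemicontinuous_dist_coe _) fun t => hcomp t n
  have hsub : ∀ t n, lexArgmin d (Φ t) (n + 1) ⊆ lexArgmin d (Φ t) n := fun t n m hm => hm.1
  have hint : ∀ t (F : Set Z), IsClosed F → (∀ n, (lexArgmin d (Φ t) n ∩ F).Nonempty) →
      (⋂ n, (lexArgmin d (Φ t) n ∩ F)).Nonempty := fun t F hF h =>
    IsCompact.nonempty_iInter_of_sequence_nonempty_isCompact_isClosed _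
      (fun n => inter_subset_inter_left _ (hsub t n)) h ((hcomp t 0).inter_right hF)
      fun n => (hcomp t n).isClosed.inter hF
  -- Two points surviving every minimization are equidistant from each point of a dense sequence,
  -- hence equal.
  have huniq : ∀ t m m', (∀ n, m ∈ lexArgmin d (Φ t) n) → (∀ n, m' ∈ lexArgmin d (Φ t) n) →
      m = m' := by
    intro t m m' hm hm'
    have heq : ∀ n, dist m (d n) = dist m' (d n) := fun n =>
      le_antisymm (EReal.coe_le_coe_iff.1 ((hm (n + 1)).2 m' (hm' n)))
        (EReal.coe_le_coe_iff.1 ((hm' (n + 1)).2 m (hm n)))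
    have hfun : (fun a => dist m a) = fun a => dist m' a :=
      (TopologicalSpace.denseRange_denseSeq Z).equalizer (by fun_prop) (by fun_prop)
        (funext heq)
    have := congrFun hfun m'
    simpa using this
  choose z hz using fun t => hint t univ isClosed_univ (by simpa using hnon t)
  simp only [inter_univ, mem_iInter] at hz
  refine ⟨z, measurable_of_isClosed fun F hF => ?_, fun t => hz t 0⟩
  convert MeasurableSet.iInter fun n => hmeas n F hF using 1
  ext t
  simp only [mem_preimage, mem_iInter, mem_ofPred_eq]
  constructor
  · exact fun h n => ⟨z t, hz t n, h⟩
  · intro h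
    obtain ⟨m, hm⟩ := hint t F hF h
    rw [mem_iInter] at hm
    rw [huniq t (z t) m (hz t) fun n => (hm n).1]
    exact (hm 0).2

/-- Solvability in a compact set of an inequality with a Carathéodory function depends measurably
on the parameter. -/
theorem measurableSet_exists_mem_le_zero [TopologicalSpace Z] [TopologicalSpace.MetrizableSpace Z]
    [SecondCountableTopology Z] {L : Set Z} (hL : IsCompact L) {ψ : T → Z → ℝ}
    (hcont : ∀ t, Continuous (ψ t)) (hmeas : ∀ m, Measurable fun t => ψ t m) :
    MeasurableSet {t | ∃ m ∈ L, ψ t m ≤ 0} := by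
  obtain ⟨D, hDL, hDc, hLD⟩ :=
    (TopologicalSpace.IsSeparable.of_separableSpace L).exists_countable_dense_subset
  -- A countable dense subset detects approximate solutions; compactness turns them into an exact
  -- one.
  have : {t | ∃ m ∈ L, ψ t m ≤ 0} = ⋂ k : ℕ, ⋃ e ∈ D, {t | ψ t e < 1 / ((k : ℝ) + 1)} := by
    ext t
    simp only [mem_iInter, mem_iUnion, mem_ofPred_eq, exists_prop]
    constructor
    · rintro ⟨m, hm, hle⟩ k
      have hopen : IsOpen {m | ψ t m < 1 / ((k : ℝ) + 1)} := isOpen_lt (hcont t) continuous_const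
      obtain ⟨e, he, heD⟩ := mem_closure_iff.1 (hLD hm) _ hopen
        (show ψ t m < 1 / ((k : ℝ) + 1) from lt_of_le_of_lt hle (by positivity))
      exact ⟨e, heD, he⟩
    · intro h
      obtain ⟨e, he, -⟩ := h 0
      obtain ⟨m, hm, hmin⟩ := hL.exists_isMinOn ⟨e, hDL he⟩ (hcont t).continuousOn
      refine ⟨m, hm, le_of_forall_pos_lt_add fun ε hε => ?_⟩
      obtain ⟨k, hk⟩ := exists_nat_one_div_lt hε
      obtain ⟨e, he, hek⟩ := h k
      have := hmin (hDL he)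
      simp only [mem_ofPred_eq] at this
      linarith
  rw [this]
  exact MeasurableSet.iInter fun k => MeasurableSet.biUnion hDc fun e _ =>
    measurableSet_lt (hmeas e) measurable_const

end Correspondences

/-! ### Compactness of the space of menus. -/

/-- Sequential compactness of the nonempty subsets of a compact set for the Hausdorff distance. -/
theorem exists_hausdorff_convergent_subseq {Z : Type*} [MetricSpace Z] {Γ : Set Z}
    (hΓ : IsCompact Γ) (D : ℕ → Set Z) (hD : ∀ n, D n ⊆ Γ) (hne : ∀ n, (D n).Nonempty) :
    ∃ (K : Set Z) (φ : ℕ → ℕ), StrictMono φ ∧ IsCompact K ∧ K ⊆ Γ ∧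
      (∀ m ∈ K, ∀ ε > 0, ∀ᶠ n in atTop, ∃ d ∈ D (φ n), dist m d < ε) ∧
      ∀ ε > 0, ∀ᶠ n in atTop, ∀ d ∈ D (φ n), ∃ m ∈ K, dist d m < ε := by
  have : CompactSpace Γ := isCompact_iff_compactSpace.1 hΓ
  let A : ℕ → TopologicalSpace.NonemptyCompacts Γ := fun n =>
    ⟨⟨closure (Subtype.val ⁻¹' D n), isClosed_closure.isCompact⟩, by
      obtain ⟨d, hd⟩ := hne n
      exact ⟨⟨d, hD n hd⟩, subset_closure hd⟩⟩
  obtain ⟨K, φ, hφ, hK⟩ := CompactSpace.tendsto_subseq A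
  have hfin : ∀ n, Metric.hausdorffEDist (A (φ n) : Set Γ) K ≠ ⊤ := fun n =>
    Metric.hausdorffEDist_ne_top_of_nonempty_of_bounded (A (φ n)).nonempty K.nonempty
      (A (φ n)).isCompact.isBounded K.isCompact.isBounded
  have hev : ∀ ε > 0, ∀ᶠ n in atTop, Metric.hausdorffDist (A (φ n) : Set Γ) K < ε := by
    intro ε hε
    filter_upwards [Metric.tendsto_nhds.1 hK ε hε] with n hn
    rwa [Metric.NonemptyCompacts.dist_eq] at hn
  refine ⟨Subtype.val '' (K : Set Γ), φ, hφ, K.isCompact.image continuous_subtype_val,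
    by rintro _ ⟨m, -, rfl⟩; exact m.2, ?_, ?_⟩
  · rintro _ ⟨m, hm, rfl⟩ ε hε
    filter_upwards [hev (ε / 2) (half_pos hε)] with n hn
    obtain ⟨a, ha, ham⟩ := Metric.exists_dist_lt_of_hausdorffDist_lt' hm hn (hfin n)
    obtain ⟨d, hd, had⟩ := Metric.mem_closure_iff.1 ha (ε / 2) (half_pos hε)
    refine ⟨d, hd, ?_⟩
    have h1 : dist (m : Z) d ≤ dist (m : Z) a + dist (a : Z) d := dist_triangle _ _ _
    have h2 : dist (a : Z) m < ε / 2 := ham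
    have h3 : dist (a : Z) d < ε / 2 := had
    rw [dist_comm] at h2
    linarith
  · intro ε hε
    filter_upwards [hev ε hε] with n hn d hd
    obtain ⟨m, hm, hdm⟩ := Metric.exists_dist_lt_of_hausdorffDist_lt
      (x := (⟨d, hD _ hd⟩ : Γ)) (subset_closure hd) hn (hfin n)
    exact ⟨m, ⟨m, hm, rfl⟩, hdm⟩

/-! ### Shifting the extended-real integral. -/

section Integral

theorem toENNReal_add_coe_add_toENNReal_neg {a : EReal} {β : ℝ} (hβ : 0 ≤ β)
    (ha : ((-β : ℝ) : EReal) ≤ a) :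
    (a + (β : EReal)).toENNReal + (-a).toENNReal = a.toENNReal + ENNReal.ofReal β := by
  induction a with
  | bot => simp at ha
  | top => simp
  | coe r =>
    have hr : -β ≤ r := EReal.coe_le_coe_iff.1 ha
    rw [← EReal.coe_add, ← EReal.coe_neg]
    simp only [EReal.real_coe_toENNReal]
    rcases le_total 0 r with h | h
    · rw [ENNReal.ofReal_of_nonpos (neg_nonpos.2 h), add_zero, ENNReal.ofReal_add h hβ]
    · rw [ENNReal.ofReal_of_nonpos h, zero_add,
        ← ENNReal.ofReal_add (by linarith) (neg_nonneg.2 h)]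
      congr 1
      ring

/-- For a function bounded below, the extended-real integral is computed by shifting the function
to a nonnegative one. -/
theorem integralEReal_eq_lintegral_sub {α : Type*} [MeasurableSpace α] (μ : Measure α)
    [IsProbabilityMeasure μ] {f : α → EReal} (hf : Measurable f) {β : ℝ} (hβ : 0 ≤ β)
    (hfβ : ∀ a, ((-β : ℝ) : EReal) ≤ f a) (hfin : ∫⁻ a, (-f a).toENNReal ∂μ < ⊤) :
    integralEReal μ f = ((∫⁻ a, (f a + (β : EReal)).toENNReal ∂μ : ℝ≥0∞) : EReal) - (β : EReal) := by
  have hneg : Measurable fun a => (-f a).toENNReal := hf.neg.ereal_toENNReal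
  have key : ∫⁻ a, (f a + (β : EReal)).toENNReal ∂μ + ∫⁻ a, (-f a).toENNReal ∂μ =
      ∫⁻ a, (f a).toENNReal ∂μ + ENNReal.ofReal β := by
    rw [← lintegral_add_right _ hneg]
    simp_rw [fun a => toENNReal_add_coe_add_toENNReal_neg hβ (hfβ a)]
    rw [lintegral_add_right _ measurable_const]
    simp
  unfold integralEReal
  generalize ∫⁻ a, (f a + (β : EReal)).toENNReal ∂μ = A at *
  generalize ∫⁻ a, (-f a).toENNReal ∂μ = v at *
  generalize ∫⁻ a, (f a).toENNReal ∂μ = u at *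
  lift v to NNReal using hfin.ne
  lift β to NNReal using hβ
  rw [ENNReal.ofReal_coe_nnreal] at key
  induction u with
  | top =>
    have : A = ⊤ := by
      by_contra h
      exact ENNReal.add_ne_top.2 ⟨h, ENNReal.coe_ne_top (r := v)⟩ (by rw [key, top_add])
    subst this
    rfl
  | coe u =>
    have hA : A ≠ ⊤ := by
      rintro rfl
      rw [top_add] at key
      exact ENNReal.add_ne_top.2 ⟨ENNReal.coe_ne_top, ENNReal.coe_ne_top⟩ key.symm
    lift A to NNReal using hA
    have h : (A : ℝ) + v = u + β := by exact_mod_cast key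
    simp only [EReal.coe_nnreal_eq_coe_real]
    norm_cast
    linarith

end Integral

/-! ### Demand, indirect utility and its jumps. -/

section Demand

variable {T Z : Type*} [MeasurableSpace T] [TopologicalSpace Z]

/-- Indirect utility of an agent with utility `u` and budget `r` facing the menu `K` with
prices `p`. -/
noncomputable def indirectUtility (K : Set Z) (p : Z → ℝ) (u : Z → ℝ) (r : ℝ) : ℝ :=
  sSup (u '' {m ∈ K | p m ≤ r})

/-- The affordable items of the menu `K` that yield the indirect utility. -/
def demand (K : Set Z) (p : Z → ℝ) (u : Z → ℝ) (r : ℝ) : Set Z :=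
  {m ∈ K | p m ≤ r ∧ indirectUtility K p u r ≤ u m}

variable {K : Set Z} {p : Z → ℝ}

theorem isCompact_affordable (hK : IsCompact K) (hp : Continuous p) (r : ℝ) :
    IsCompact {m ∈ K | p m ≤ r} :=
  hK.inter_right (isClosed_le hp continuous_const)

theorem le_indirectUtility (hK : IsCompact K) (hp : Continuous p) {u : Z → ℝ} (hu : Continuous u)
    {r : ℝ} {m : Z} (hm : m ∈ K) (hmr : p m ≤ r) : u m ≤ indirectUtility K p u r :=
  le_csSup ((isCompact_affordable hK hp r).image hu).bddAbove ⟨m, ⟨hm, hmr⟩, rfl⟩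

theorem demand_nonempty (hK : IsCompact K) (hp : Continuous p) {u : Z → ℝ} (hu : Continuous u)
    {r : ℝ} {m₀ : Z} (hm₀ : m₀ ∈ K) (hr : p m₀ ≤ r) : (demand K p u r).Nonempty := by
  obtain ⟨m, hm, heq⟩ := ((isCompact_affordable hK hp r).image hu).sSup_mem
    ⟨u m₀, m₀, ⟨hm₀, hr⟩, rfl⟩
  exact ⟨m, hm.1, hm.2, heq.ge⟩

theorem isCompact_demand (hK : IsCompact K) (hp : Continuous p) {u : Z → ℝ} (hu : Continuous u)
    (r : ℝ) : IsCompact (demand K p u r) :=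
  hK.inter_right ((isClosed_le hp continuous_const).inter (isClosed_le continuous_const hu))

/-- At a jump, every value at a smaller budget lies below a gap of length `1 / (k + 1)` under the
current value. A rational chosen in each gap increases strictly with the budget, so the jumps inject
into `ℚ`. -/
theorem countable_jump_budgets (hK : IsCompact K) (hp : Continuous p) {u : Z → ℝ}
    (hu : Continuous u) {B : Set ℝ} {m₀ : Z} (hm₀ : m₀ ∈ K) (hB : ∀ r ∈ B, p m₀ ≤ r) :
    {r ∈ B | ∃ k : ℕ, ∀ m ∈ K, p m < r →
      u m + 1 / ((k : ℝ) + 1) ≤ indirectUtility K p u r}.Countable := by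
  choose! k hk using fun r (hr : r ∈ {r ∈ B | ∃ k : ℕ, ∀ m ∈ K, p m < r →
      u m + 1 / ((k : ℝ) + 1) ≤ indirectUtility K p u r}) => hr.2
  choose q hq using fun r => exists_rat_btwn
    (show indirectUtility K p u r - 1 / ((k r : ℝ) + 1) < indirectUtility K p u r from
      sub_lt_self _ (by positivity))
  have hmono : StrictMonoOn q {r ∈ B | ∃ k : ℕ, ∀ m ∈ K, p m < r →
      u m + 1 / ((k : ℝ) + 1) ≤ indirectUtility K p u r} := by
    intro r hr s hs hrs
    obtain ⟨m, hm, hmr, hle⟩ := demand_nonempty hK hp hu hm₀ (hB r hr.1)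
    have h1 := hk s hs m hm (hmr.trans_lt hrs)
    have : (q r : ℝ) < q s := by linarith [(hq r).2, (hq s).1]
    exact_mod_cast this
  exact (mapsTo_univ q _).countable_of_injOn hmono.injOn countable_univ

variable [TopologicalSpace.MetrizableSpace Z] [SecondCountableTopology Z]
  {U : T → Z → ℝ} {b : T → ℝ} {m₀ : Z}

theorem measurable_indirectUtility (hK : IsCompact K) (hp : Continuous p)
    (hU : ∀ t, Continuous (U t)) (hUm : ∀ m, Measurable fun t => U t m) (hb : Measurable b)
    (hm₀ : m₀ ∈ K) (hmb : ∀ t, p m₀ ≤ b t) :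
    Measurable fun t => indirectUtility K p (U t) (b t) := by
  refine measurable_of_Ici fun c => ?_
  -- The maximum encodes affordability and utility at least `c` as one inequality.
  convert measurableSet_exists_mem_le_zero (ψ := fun t m => max (p m - b t) (c - U t m)) hK
    (fun t => (hp.sub continuous_const).max (continuous_const.sub (hU t)))
    (fun m => (measurable_const.sub hb).max (measurable_const.sub (hUm m))) using 1
  ext t
  simp only [mem_preimage, mem_Ici, mem_ofPred_eq, max_le_iff, sub_nonpos]
  constructor
  · intro h
    obtain ⟨m, hm, hmr, hle⟩ := demand_nonempty hK hp (hU t) hm₀ (hmb t)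
    exact ⟨m, hm, hmr, h.trans hle⟩
  · rintro ⟨m, hm, hmr, hle⟩
    exact hle.trans (le_indirectUtility hK hp (hU t) hm hmr)

theorem hitMeasurable_demand (hK : IsCompact K) (hp : Continuous p)
    (hU : ∀ t, Continuous (U t)) (hUm : ∀ m, Measurable fun t => U t m) (hb : Measurable b)
    (hm₀ : m₀ ∈ K) (hmb : ∀ t, p m₀ ≤ b t) :
    HitMeasurable fun t => demand K p (U t) (b t) := by
  intro F hF
  have hW := measurable_indirectUtility hK hp hU hUm hb hm₀ hmb
  convert measurableSet_exists_mem_le_zero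
    (ψ := fun t m => max (p m - b t) (indirectUtility K p (U t) (b t) - U t m))
    (hK.inter_right hF)
    (fun t => (hp.sub continuous_const).max (continuous_const.sub (hU t)))
    (fun m => (measurable_const.sub hb).max (hW.sub (hUm m))) using 1
  ext t
  simp only [mem_ofPred_eq, max_le_iff, sub_nonpos]
  constructor
  · rintro ⟨m, ⟨hm, h⟩, hmF⟩
    exact ⟨m, ⟨hm, hmF⟩, h⟩
  · rintro ⟨m, ⟨hm, hmF⟩, h⟩
    exact ⟨m, ⟨hm, h⟩, hmF⟩

/-- Among the optimal choices of the agents, the cheapest ones can be selected measurably. -/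
theorem exists_measurable_cheapest_demand {T Z : Type*} [MeasurableSpace T] [MetricSpace Z]
    [SecondCountableTopology Z] [MeasurableSpace Z] [BorelSpace Z] {K : Set Z} {p : Z → ℝ}
    {U : T → Z → ℝ} {b : T → ℝ} {m₀ : Z} (hK : IsCompact K) (hp : Continuous p)
    (hU : ∀ t, Continuous (U t)) (hUm : ∀ m, Measurable fun t => U t m) (hb : Measurable b)
    (hm₀ : m₀ ∈ K) (hmb : ∀ t, p m₀ ≤ b t) {C : Z → EReal} (hC : LowerSemicontinuous C) :
    ∃ z : T → Z, Measurable z ∧ ∀ t, z t ∈ demand K p (U t) (b t) ∧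
      ∀ m ∈ demand K p (U t) (b t), C (z t) ≤ C m := by
  have hc : ∀ t, IsCompact (demand K p (U t) (b t)) := fun t => isCompact_demand hK hp (hU t) _
  obtain ⟨z, hz, hzmem⟩ := HitMeasurable.exists_measurable_selection
    ((hitMeasurable_demand hK hp hU hUm hb hm₀ hmb).argminOn hC hc)
    (fun t => isCompact_argminOn hC (hc t))
    (fun t => argminOn_nonempty hC (hc t) (demand_nonempty hK hp (hU t) hm₀ (hmb t)))
  exact ⟨z, hz, hzmem⟩

/-- The types whose indirect utility jumps at their budget: strictly cheaper items are worse by a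
uniform amount. -/
def jumpSet (K : Set Z) (p : Z → ℝ) (U : T → Z → ℝ) (b : T → ℝ) : Set T :=
  {t | ∃ k : ℕ, ∀ m ∈ K, p m < b t →
    U t m + 1 / ((k : ℝ) + 1) ≤ indirectUtility K p (U t) (b t)}

theorem measurableSet_jumpSet (hK : IsCompact K) (hp : Continuous p)
    (hU : ∀ t, Continuous (U t)) (hUm : ∀ m, Measurable fun t => U t m) (hb : Measurable b)
    (hm₀ : m₀ ∈ K) (hmb : ∀ t, p m₀ ≤ b t) : MeasurableSet (jumpSet K p U b) := by
  obtain ⟨D, hDK, hDc, hKD⟩ :=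
    (TopologicalSpace.IsSeparable.of_separableSpace K).exists_countable_dense_subset
  have hW := measurable_indirectUtility hK hp hU hUm hb hm₀ hmb
  have : jumpSet K p U b = ⋃ k : ℕ, ⋂ e ∈ D, ({t | b t ≤ p e} ∪
      {t | U t e + 1 / ((k : ℝ) + 1) ≤ indirectUtility K p (U t) (b t)}) := by
    ext t
    simp only [jumpSet, mem_ofPred_eq, mem_iUnion, mem_iInter, mem_union]
    refine exists_congr fun k => ⟨fun h e he => ?_, fun h m hm hmb => ?_⟩
    · exact or_iff_not_imp_left.2 fun hlt => h e (hDK he) (not_le.1 hlt)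
    -- Violating the gap is an open condition on `m`, so a violation already occurs in `D`.
    · by_contra hlt
      have hopen : IsOpen {m | p m < b t ∧
          indirectUtility K p (U t) (b t) < U t m + 1 / ((k : ℝ) + 1)} :=
        (isOpen_lt hp continuous_const).inter
          (isOpen_lt continuous_const ((hU t).add continuous_const))
      obtain ⟨e, ⟨he, he'⟩, heD⟩ := mem_closure_iff.1 (hKD hm) _ hopen ⟨hmb, not_le.1 hlt⟩
      exact (h e heD).elim he.not_ge he'.not_ge
  rw [this]
  exact MeasurableSet.iUnion fun k => MeasurableSet.biInter hDc fun e _ =>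
    (measurableSet_le hb measurable_const).union
      (measurableSet_le ((hUm e).add measurable_const) hW)

end Demand

/-! ### Passing to the limit menu. -/

variable {X Q : Type*} {Y : Set ℝ}
  {V : X → ℝ × Q → ℝ} {C : ℝ × Q → EReal} {z₀ : ℝ × Q}

theorem le_of_mem_coercivitySet [TopologicalSpace Q] (hC : LowerSemicontinuous C) {m : ℝ × Q}
    (hm : m ∈ coercivitySet Y V C z₀) : C m ≤ C z₀ :=
  closure_minimal (fun _ h => h.1) (hC.isClosed_preimage (C z₀)) hm

/-- Limits of the choices of a type at which the indirect utility of the limit menu does not jump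
belong to its demand in the limit menu. -/
theorem mem_demand_of_frequently_mem_nhds [MetricSpace Q] {K : Set (ℝ × Q)} (hK : IsCompact K)
    (hVcont : ∀ x, Continuous (V x)) {D : ℕ → Set (ℝ × Q)} {z : ℕ → ℝ × Q} {t : X × Y}
    (hKD : ∀ m ∈ K, ∀ ε > 0, ∀ᶠ n in atTop, ∃ d ∈ D n, dist m d < ε)
    (hDK : ∀ ε > 0, ∀ᶠ n in atTop, ∀ d ∈ D n, ∃ m ∈ K, dist d m < ε)
    (hbudget : ∀ n, (z n).1 ≤ t.2)
    (hbest : ∀ n, ∀ d ∈ D n, d.1 ≤ t.2 → V t.1 d ≤ V t.1 (z n))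
    (ht : t ∉ jumpSet K Prod.fst (fun t : X × Y => V t.1) (fun t => (t.2 : ℝ)))
    {l : ℝ × Q} (hl : ∀ U ∈ 𝓝 l, ∃ᶠ n in atTop, z n ∈ U ∧ z n ∈ D n) :
    l ∈ demand K Prod.fst (V t.1) t.2 := by
  have hlfst : l.1 ≤ t.2 := by
    by_contra hlt
    obtain ⟨n, hn, -⟩ := (hl {m | (t.2 : ℝ) < m.1}
      ((isOpen_lt continuous_const continuous_fst).mem_nhds (not_le.1 hlt))).exists
    exact (hbudget n).not_gt hn
  have hlK : l ∈ K := by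
    rw [← hK.isClosed.closure_eq, Metric.mem_closure_iff]
    intro ε hε
    obtain ⟨n, ⟨hn, hnD⟩, hn'⟩ := ((hl _ (Metric.ball_mem_nhds l (half_pos hε))).and_eventually
      (hDK (ε / 2) (half_pos hε))).exists
    obtain ⟨m, hm, hdist⟩ := hn' _ hnD
    refine ⟨m, hm, ?_⟩
    rw [Metric.mem_ball, dist_comm] at hn
    linarith [dist_triangle l (z n) m]
  -- Strict inequality makes nearby items of `D n` affordable too, so they compete with `z n`.
  have hbetter : ∀ m ∈ K, m.1 < t.2 → V t.1 m ≤ V t.1 l := by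
    intro m hm hmt
    by_contra hlt
    obtain ⟨c, hc1, hc2⟩ := exists_between (not_le.1 hlt)
    have hopen : IsOpen {d : ℝ × Q | d.1 < t.2 ∧ c < V t.1 d} :=
      (isOpen_lt continuous_fst continuous_const).inter (isOpen_lt continuous_const (hVcont _))
    obtain ⟨ε, hε, hball⟩ := Metric.isOpen_iff.1 hopen m ⟨hmt, hc2⟩
    obtain ⟨n, ⟨hn, -⟩, d, hd, hdist⟩ := ((hl {m | V t.1 m < c}
      ((isOpen_lt (hVcont _) continuous_const).mem_nhds hc1)).and_eventually
      (hKD m hm ε hε)).exists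
    obtain ⟨hd1, hd2⟩ := hball (show d ∈ Metric.ball m ε by rwa [Metric.mem_ball, dist_comm])
    exact absurd (hbest n d hd hd1.le) (not_le.2 (lt_trans hn hd2))
  refine ⟨hlK, hlfst, le_of_forall_pos_lt_add fun ε hε => ?_⟩
  obtain ⟨k, hk⟩ := exists_nat_one_div_lt hε
  simp only [jumpSet, mem_ofPred_eq, not_exists, not_forall, not_le] at ht
  obtain ⟨m, hm, hmt, hgap⟩ := ht k
  linarith [hbetter m hm hmt]

/-- Lower semicontinuity of the cost of a type at which the indirect utility of the limit menu
does not jump. -/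
theorem le_liminf_cost [MetricSpace Q] {Γ K : Set (ℝ × Q)} (hΓ : IsCompact Γ) (hK : IsCompact K)
    (hVcont : ∀ x, Continuous (V x)) {D : ℕ → Set (ℝ × Q)} {z : ℕ → ℝ × Q} {t : X × Y}
    (hKD : ∀ m ∈ K, ∀ ε > 0, ∀ᶠ n in atTop, ∃ d ∈ D n, dist m d < ε)
    (hDK : ∀ ε > 0, ∀ᶠ n in atTop, ∀ d ∈ D n, ∃ m ∈ K, dist d m < ε)
    (hDΓ : ∀ n, D n ⊆ Γ) (hcheap : ∀ n, C (z n) ≤ C z₀ → z n ∈ D n)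
    (hbudget : ∀ n, (z n).1 ≤ t.2)
    (hbest : ∀ n, ∀ d ∈ D n, d.1 ≤ t.2 → V t.1 d ≤ V t.1 (z n))
    (ht : t ∉ jumpSet K Prod.fst (fun t : X × Y => V t.1) (fun t => (t.2 : ℝ)))
    {g : EReal → ℝ≥0∞} (hg : Monotone g) (hgC : LowerSemicontinuous fun m => g (C m))
    {w : ℝ × Q} (hw₀ : C w ≤ C z₀)
    (hw : ∀ m ∈ demand K Prod.fst (V t.1) t.2, C w ≤ C m) :
    g (C w) ≤ liminf (fun n => g (C (z n))) atTop := by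
  by_contra hlt
  obtain ⟨c, hc1, hc2⟩ := exists_between (not_le.1 hlt)
  have hfreq : ∃ᶠ n in atTop, g (C (z n)) < c := frequently_lt_of_liminf_lt (by isBoundedDefault) hc1
  have hmem : ∃ᶠ n in atTop, z n ∈ Γ ∩ {m | g (C m) ≤ c} ∧ z n ∈ D n := by
    refine hfreq.mono fun n hn => ?_
    -- A choice cheaper than `w` is cheaper than `z₀`, so it was kept in the menu `D n ⊆ Γ`.
    have hlt : C (z n) < C w := hg.reflect_lt (hn.trans hc2)
    have hD := hcheap n (hlt.le.trans hw₀)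
    exact ⟨⟨hDΓ n hD, hn.le⟩, hD⟩
  have hcomp : IsCompact (Γ ∩ {m | g (C m) ≤ c}) := hΓ.inter_right (hgC.isClosed_preimage c)
  let F : Filter ℕ := atTop ⊓ 𝓟 {n | z n ∈ Γ ∩ {m | g (C m) ≤ c} ∧ z n ∈ D n}
  have hF : F.NeBot := frequently_mem_iff_neBot.1 hmem
  obtain ⟨l, ⟨-, hlc⟩, hl⟩ := hcomp.exists_mapClusterPt (f := F) (u := z)
    (tendsto_principal.2 (mem_inf_of_right fun n hn => hn.1))
  have hlD : l ∈ demand K Prod.fst (V t.1) t.2 := by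
    refine mem_demand_of_frequently_mem_nhds hK hVcont hKD hDK hbudget hbest ht fun U hU => ?_
    have h1 := hl.frequently hU
    rw [frequently_inf_principal] at h1
    exact h1.mono fun n hn => ⟨hn.2, hn.1.2⟩
  exact absurd ((hg (hw l hlD)).trans hlc) (not_le.2 hc2)

variable [MeasurableSpace X] [MeasurableSpace Q]

theorem isFeasible_const (h : ∀ y : Y, z₀.1 ≤ y) : IsFeasible V z₀ fun _ : X × Y => z₀ :=
  ⟨measurable_const, fun _ y => h y, fun _ _ => le_rfl, fun _ _ _ _ _ => le_rfl⟩

theorem IsFeasible.mem_coercivitySet [TopologicalSpace Q] {z : X × Y → ℝ × Q}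
    (hz : IsFeasible V z₀ z) {t : X × Y} (ht : C (z t) ≤ C z₀) :
    z t ∈ coercivitySet Y V C z₀ :=
  subset_closure ⟨ht, t.1, t.2, hz.budget _ _, hz.individuallyRational _ _⟩

/-- The cost is bounded below along all feasible contracts. -/
theorem exists_lower_bound [TopologicalSpace Q] [Nonempty (X × Y)]
    (hY : ∀ y : Y, z₀.1 ≤ y) (hCbot : ∀ z, C z ≠ ⊥) (hC : LowerSemicontinuous C)
    (hcoercive : IsCompact (coercivitySet Y V C z₀)) :
    ∃ β : ℝ, 0 ≤ β ∧ ∀ z : X × Y → ℝ × Q, IsFeasible V z₀ z →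
      ∀ t, ((-β : ℝ) : EReal) ≤ C (z t) := by
  obtain ⟨t₀⟩ := ‹Nonempty (X × Y)›
  have h₀ : z₀ ∈ coercivitySet Y V C z₀ :=
    (isFeasible_const hY).mem_coercivitySet (t := t₀) le_rfl
  obtain ⟨m, hm, hmin⟩ := (hC.lowerSemicontinuousOn _).exists_isMinOn ⟨z₀, h₀⟩ hcoercive
  obtain ⟨c, hc⟩ : ∃ c : ℝ, (c : EReal) ≤ C m := by
    obtain ⟨c, -, hc⟩ := EReal.lt_iff_exists_real_btwn.1 (bot_lt_iff_ne_bot.2 (hCbot m))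
    exact ⟨c, hc.le⟩
  refine ⟨|c|, abs_nonneg c, fun z hz t => ?_⟩
  refine (EReal.coe_le_coe_iff.2 (neg_abs_le c)).trans (hc.trans ?_)
  -- Items no costlier than `z₀` lie in the compact set minimized over; the others cost at least `C
  -- z₀ ≥ C m`.
  rcases le_total (C (z t)) (C z₀) with h | h
  · exact hmin (hz.mem_coercivitySet h)
  · exact (le_of_mem_coercivitySet hC hm).trans h

/-- The items of a contract that are at most as costly as the outside option, together with the
outside option. -/
def cheapMenu (C : ℝ × Q → EReal) (z₀ : ℝ × Q) (z : X × Y → ℝ × Q) : Set (ℝ × Q) :=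
  insert z₀ {m | C m ≤ C z₀ ∧ ∃ t, z t = m}

/-- The choice `z t` may be too costly to belong to the cheap menu, but it still beats every
affordable item there. -/
theorem IsFeasible.le_of_mem_cheapMenu {z : X × Y → ℝ × Q} (hz : IsFeasible V z₀ z)
    {m : ℝ × Q} (hm : m ∈ cheapMenu C z₀ z) {t : X × Y} (ht : m.1 ≤ t.2) :
    V t.1 m ≤ V t.1 (z t) := by
  rcases hm with rfl | ⟨-, s, rfl⟩
  · exact hz.individuallyRational _ _
  · exact hz.incentiveCompatible _ _ s.1 s.2 ht

/-- A contract selecting from the demands of all types in a menu containing the outside option is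
feasible. -/
theorem isFeasible_of_mem_demand [TopologicalSpace Q] {K : Set (ℝ × Q)} (hK : IsCompact K)
    (hVcont : ∀ x, Continuous (V x)) (hY : ∀ y : Y, z₀.1 ≤ y) (h₀ : z₀ ∈ K)
    {z : X × Y → ℝ × Q} (hz : Measurable z)
    (hmem : ∀ t, z t ∈ demand K Prod.fst (V t.1) t.2) : IsFeasible V z₀ z where
  measurable := hz
  budget x y := (hmem (x, y)).2.1
  individuallyRational x y :=
    (le_indirectUtility hK continuous_fst (hVcont x) h₀ (hY y)).trans (hmem (x, y)).2.2
  incentiveCompatible x y x' y' h :=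
    (le_indirectUtility hK continuous_fst (hVcont x) (hmem (x', y')).1 h).trans (hmem (x, y)).2.2

end BudgetPrincipalAgent

/-! ### Existence of an optimal contract. -/

open BudgetPrincipalAgent Filter Topology in
theorem theorem5p2 {X Q : Type*} [MeasurableSpace X]
    [TopologicalSpace Q] [PolishSpace Q] [MeasurableSpace Q] [BorelSpace Q]
    -- the set of budgets: a closed interval with finite least element
    (Y : Set ℝ) (ymin : ℝ) (hYclosed : IsClosed Y) (hYinterval : Y.OrdConnected)
    (hYmin : IsLeast Y ymin)
    -- the joint distribution of types
    (θ : MeasureTheory.Measure (X × Y)) [MeasureTheory.IsProbabilityMeasure θ]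
    (V : X → ℝ × Q → ℝ) (C : ℝ × Q → EReal) (z₀ : ℝ × Q)
    (hz₀ : z₀.1 ≤ ymin)
    (hVcont : ∀ x, Continuous (V x))
    (hVmeas : ∀ z, Measurable fun x => V x z)
    (hCbot : ∀ z, C z ≠ ⊥)
    (hClsc : LowerSemicontinuous C)
    (hCz₀ : C z₀ < ⊤)
    (hcoercive : IsCompact (BudgetPrincipalAgent.coercivitySet Y V C z₀))
    (hnonatomic : ∀ S : Set (X × Y), MeasurableSet S →
      (∀ x : X, {y : Y | (x, y) ∈ S}.Countable) → θ S = 0) :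
    -- the expected cost of every feasible contract is well defined in `(-∞, +∞]`
    (∀ z : X × Y → ℝ × Q, BudgetPrincipalAgent.IsFeasible V z₀ z →
      Measurable (fun t => C (z t)) ∧ ∫⁻ t, (-C (z t)).toENNReal ∂θ < ⊤) ∧
    ∃ z : X × Y → ℝ × Q, BudgetPrincipalAgent.IsOptimal θ V C z₀ z := by
  let _ := TopologicalSpace.upgradeIsCompletelyMetrizable Q
  have hne : Nonempty (X × Y) := nonempty_of_isProbabilityMeasure θ
  have hY : ∀ y : Y, z₀.1 ≤ y := fun y => hz₀.trans (hYmin.2 y.2)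
  obtain ⟨β, hβ, hlow⟩ := exists_lower_bound (X := X) (V := V) hY hCbot hClsc hcoercive
  have hwell : ∀ z : X × Y → ℝ × Q, IsFeasible V z₀ z →
      Measurable (fun t => C (z t)) ∧ ∫⁻ t, (-C (z t)).toENNReal ∂θ < ⊤ := by
    intro z hz
    refine ⟨hClsc.measurable.comp hz.measurable, ?_⟩
    calc ∫⁻ t, (-C (z t)).toENNReal ∂θ ≤ ∫⁻ _, ENNReal.ofReal β ∂θ := by
          refine lintegral_mono fun t => ?_
          rw [← EReal.real_coe_toENNReal]
          refine EReal.toENNReal_le_toENNReal (EReal.neg_le.1 ?_)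
          rw [← EReal.coe_neg]
          exact hlow z hz t
      _ < ⊤ := by simp
  refine ⟨hwell, ?_⟩
  -- The shift by `β` makes feasible costs nonnegative, as Fatou's lemma needs; it changes every
  -- expected cost by the same constant.
  let g : EReal → ℝ≥0∞ := fun a => (a + (β : EReal)).toENNReal
  have hg : Monotone g := fun a b h => EReal.toENNReal_le_toENNReal (by gcongr)
  have hgcont : Continuous g := by
    refine Continuous.ereal_toENNReal (continuous_iff_continuousAt.2 fun a => ?_)
    exact (EReal.continuousAt_add (p := (a, (β : EReal))) (by simp) (by simp)).comp
      (f := fun a : EReal => (a, (β : EReal))) (by fun_prop)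
  have hgC : LowerSemicontinuous fun m => g (C m) := hgcont.comp_lowerSemicontinuous hClsc hg
  have hcost : ∀ z : X × Y → ℝ × Q, IsFeasible V z₀ z → expectedCost θ C z =
      ((∫⁻ t, g (C (z t)) ∂θ : ℝ≥0∞) : EReal) - (β : EReal) := fun z hz =>
    integralEReal_eq_lintegral_sub θ (hwell z hz).1 hβ (hlow z hz) (hwell z hz).2
  let costs : Set ℝ≥0∞ := (fun z : X × Y → ℝ × Q => ∫⁻ t, g (C (z t)) ∂θ) '' {z | IsFeasible V z₀ z}
  have hcosts : costs.Nonempty := ⟨_, _, isFeasible_const hY, rfl⟩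
  obtain ⟨u, -, hu, hmem⟩ := exists_seq_tendsto_sInf hcosts (OrderBot.bddBelow _)
  choose w hw hwu using hmem
  obtain ⟨K, φ, hφ, hK, hKΓ, hKD, hDK⟩ := exists_hausdorff_convergent_subseq hcoercive
    (fun n => cheapMenu C z₀ (w n))
    (by
      rintro n m (rfl | ⟨hm, t, rfl⟩)
      · exact (isFeasible_const hY).mem_coercivitySet (t := hne.some) le_rfl
      · exact (hw n).mem_coercivitySet hm)
    (fun n => ⟨z₀, Set.mem_insert _ _⟩)
  have h₀K : z₀ ∈ K := by
    rw [← hK.isClosed.closure_eq, Metric.mem_closure_iff]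
    intro ε hε
    obtain ⟨n, hn⟩ := (hDK ε hε).exists
    exact hn z₀ (Set.mem_insert _ _)
  have hb : Measurable fun t : X × Y => (t.2 : ℝ) := measurable_subtype_coe.comp measurable_snd
  have hVm : ∀ m, Measurable fun t : X × Y => V t.1 m := fun m => (hVmeas m).comp measurable_fst
  have hVc : ∀ t : X × Y, Continuous (V t.1) := fun t => hVcont t.1
  obtain ⟨z, hz, hzmem⟩ := exists_measurable_cheapest_demand hK continuous_fst hVc hVm hb h₀K
    (fun t => hY t.2) hClsc
  have hfeas : IsFeasible V z₀ z :=
    isFeasible_of_mem_demand hK hVcont hY h₀K hz fun t => (hzmem t).1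
  -- Each slice at fixed `x` consists of jump budgets of a single utility.
  have hnull : θ (jumpSet K Prod.fst (fun t : X × Y => V t.1) (fun t => (t.2 : ℝ))) = 0 := by
    refine hnonatomic _ (measurableSet_jumpSet hK continuous_fst hVc hVm hb h₀K
      fun t => hY t.2) fun x => ?_
    have := (countable_jump_budgets hK continuous_fst (hVcont x) h₀K
      (B := Y) fun r hr => hY ⟨r, hr⟩).preimage (f := ((↑) : Y → ℝ)) Subtype.val_injective
    exact this.mono fun y hy => And.intro y.2 hy
  refine ⟨z, hfeas, fun v hv => ?_⟩
  rw [hcost z hfeas, hcost v hv]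
  refine EReal.sub_le_sub (EReal.coe_ennreal_le_coe_ennreal_iff.2 ?_) le_rfl
  calc ∫⁻ t, g (C (z t)) ∂θ
      ≤ ∫⁻ t, liminf (fun n => g (C (w (φ n) t))) atTop ∂θ := by
        refine lintegral_mono_ae ?_
        filter_upwards [measure_eq_zero_iff_ae_notMem.1 hnull] with t ht
        exact le_liminf_cost hcoercive hK hVcont hKD hDK
          (by
            rintro n m (rfl | ⟨hm, t, rfl⟩)
            · exact hKΓ h₀K
            · exact (hw _).mem_coercivitySet hm)
          (fun n hn => Or.inr ⟨hn, t, rfl⟩) (fun n => (hw _).budget t.1 t.2)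
          (fun n d hd hdt => (hw _).le_of_mem_cheapMenu hd hdt) ht hg hgC
          (le_of_mem_coercivitySet hClsc (hKΓ (hzmem t).1.1)) (hzmem t).2
    _ ≤ liminf (fun n => ∫⁻ t, g (C (w (φ n) t)) ∂θ) atTop :=
        lintegral_liminf_le fun n => hgcont.measurable.comp (hwell _ (hw _)).1
    _ = sInf costs := by
        have : Tendsto (fun n => ∫⁻ t, g (C (w (φ n) t)) ∂θ) atTop (𝓝 (sInf costs)) := by
          refine (hu.comp hφ.tendsto_atTop).congr fun n => ?_
          exact (hwu _).symm
        exact this.liminf_eq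
    _ ≤ ∫⁻ t, g (C (v t)) ∂θ := sInf_le ⟨v, hv, rfl⟩
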